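/- Let $p$ be an odd prime number and let $A \subset \mathbb{Z}/p\mathbb{Z}$ be such that $A \cap (-A) = \emptyset$, where $-A = \{-a \mid a \in A\}$. Let $$\Sigma(A) = \Big\{ \sum_{x \in I} x \;\Big|\; I \subseteq A \Big\}, \qquad \Sigma^*(A) = \Big\{ \sum_{x \in I} x \;\Big|\; \emptyset \neq I \subseteq A \Big\}$$ be the set of all subset sums of $A$ (the empty sum being $0$) and the set of all nonempty subset sums of $A$. Then $$|\Sigma(A)| \geq \min\left\{ p,\ 1 + \frac{|A|(|A|+1)}{2} \right\} \qquad\text{and}\qquad |\Sigma^*(A)| \geq \min\left\{ p,\ \frac{|A|(|A|+1)}{2} \right\}.$$ -/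

import Mathlib

open scoped Pointwise

/-- The set of nontrivial subsums `Σ*(A) = {∑_{x ∈ I} x | ∅ ⊊ I ⊆ A}` of a subset `A`
of `ℤ/pℤ`. The set `Σ(A) = {∑_{x ∈ I} x | ∅ ⊆ I ⊆ A}` of all subsums is Mathlib's
`Finset.subsetSum A`. -/
def nontrivialSubsums {p : ℕ} (A : Finset (ZMod p)) : Finset (ZMod p) :=
  (A.powerset.filter fun I => I.Nonempty).image fun I => ∑ x ∈ I, x

theorem mem_nontrivialSubsums {p : ℕ} {A : Finset (ZMod p)} {s : ZMod p} :
    s ∈ nontrivialSubsums A ↔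
      ∃ I : Finset (ZMod p), (I ⊆ A ∧ I.Nonempty) ∧ ∑ x ∈ I, x = s := by
  simp [nontrivialSubsums]

/-!
The proof is the polynomial method, in the form used by Alon, Nathanson and Ruzsa, applied to
signed sums. Put `d = #A`. As `A` and `-A` are disjoint, `A ∪ -A` has `2 * d` nonzero elements. If
`x 1, …, x d` lie in `A ∪ -A` and have distinct squares, then up to order they are the elements of
`A` with some signs changed, so `∑ i, x i = 2 * σ - ∑ a ∈ A, a` where `σ` is the sum of the subset
`I` of those `a ∈ A` that carry the sign `+` (`exists_subset_sum_eq_two_mul_sub`). So there are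
at least as many subset sums as there are sums of this kind.

Restrict `x i` to a set `S i ⊆ A ∪ -A` with more than `k i` elements, where the `k i` are the
elements of `{d - 1, …, 2 * d - 1}` in increasing order with one element `d - 1 + r` left out, and
put `m = d * (d + 1) / 2 - r`, so that `∑ i, k i = d * (d - 1) + m`. If all the sums lay in a set of
at most `m < p` elements, the Combinatorial Nullstellensatz would be violated by the Vandermonde
determinant in the `X i ^ 2` times `m` linear factors `∑ i, X i - b`: its coefficient at
`∏ i, X i ^ k i` is `m !` times the determinant of the `1 / (k i - 2 * j)!`
(`coeff_det_vandermonde_sq_mul_sum_X_pow`). This determinant is nonzero modulo `p`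
(`det_inv_factorial_ne_zero`): a linear relation between its rows produces an odd polynomial of
degree at most `2 * d - 1` divisible by `(1 + X) ^ (d - 1)`, hence a multiple of
`X * (1 - X ^ 2) ^ (d - 1)`, and the missing exponent forces that multiple to be zero.

Thus there are at least `1 + d * (d + 1) / 2 - r` sums whenever this number is at most `p`. The
choice `r = 0` gives the bound for all subset sums. For `r ≠ 0` the smallest `k i` is `d - 1`, so
that one of the sets `S i` may be taken to be `A`; then `I` is never empty, which gives the bound
for nonempty subset sums.
Values of `m` up to `p - 1` below the triangular number of `#A` are all reached by varying `r ≠ 0`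
and replacing `A` by a subset.
-/

/-! ### Odd polynomials and the determinant of inverse factorials -/

section OddPolynomials

open Polynomial
open scoped Nat

variable {F : Type*} [Field F]

theorem natCast_factorial_ne_zero_of_le {a b : ℕ} (hab : a ≤ b) (hb : ((b ! : ℕ) : F) ≠ 0) :
    ((a ! : ℕ) : F) ≠ 0 := by
  obtain ⟨c, hc⟩ := Nat.factorial_dvd_factorial hab
  rw [hc, Nat.cast_mul] at hb
  exact left_ne_zero_of_mul hb

theorem natCast_ne_zero_of_le_of_factorial {a b : ℕ} (ha : a ≠ 0) (hab : a ≤ b)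
    (hb : ((b ! : ℕ) : F) ≠ 0) : (a : F) ≠ 0 := by
  obtain ⟨c, hc⟩ := Nat.dvd_factorial (Nat.pos_of_ne_zero ha) hab
  rw [hc, Nat.cast_mul] at hb
  exact left_ne_zero_of_mul hb

theorem natCast_choose_ne_zero_of_factorial {a b : ℕ} (hab : a ≤ b) (hb : ((b ! : ℕ) : F) ≠ 0) :
    ((b.choose a : ℕ) : F) ≠ 0 := by
  rw [← Nat.choose_mul_factorial_mul_factorial hab, mul_assoc, Nat.cast_mul] at hb
  exact left_ne_zero_of_mul hb

theorem comp_neg_X_eq_neg_of_coeff_even_eq_zero {H : F[X]} (h : ∀ j, H.coeff (2 * j) = 0) :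
    H.comp (-X) = -H := by
  ext m
  rw [show (-X : F[X]) = C (-1) * X by simp, comp_C_mul_X_coeff, coeff_neg]
  rcases Nat.even_or_odd' m with ⟨j, rfl | rfl⟩
  · simp [h]
  · simp [pow_succ, pow_mul]

/-- An odd polynomial of degree at most `2 * n + 1` that is divisible by `(1 + X) ^ n` is also
divisible by `(1 - X) ^ n` and by `X`, which leaves only one free coefficient. -/
theorem eq_C_mul_of_odd_of_dvd (h2 : (2 : F) ≠ 0) {n : ℕ} {H : F[X]}
    (hdeg : H.natDegree ≤ 2 * n + 1) (hodd : ∀ j, H.coeff (2 * j) = 0)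
    (hdvd : (X + 1) ^ n ∣ H) :
    ∃ γ : F, H = C γ * ((X + 1) ^ n * (X * (X - 1) ^ n)) := by
  have hcop : IsCoprime (X + 1 : F[X]) (X - 1) := by
    refine ⟨C (2⁻¹), -C (2⁻¹), ?_⟩
    have : (C (2⁻¹) : F[X]) * C 2 = 1 := by rw [← C_mul, inv_mul_cancel₀ h2, C_1]
    calc _ = (C (2⁻¹) : F[X]) * C 2 := by rw [show (C 2 : F[X]) = 2 from rfl]; ring
      _ = 1 := this
  have h0 : X ∣ H := X_dvd_iff.2 (by simpa using hodd 0)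
  have hm : (X - 1) ^ n ∣ H := by
    obtain ⟨Q, hQ⟩ := hdvd
    have h1 : -H = (-X + 1) ^ n * Q.comp (-X) := by
      rw [← comp_neg_X_eq_neg_of_coeff_even_eq_zero hodd, hQ]
      simp
    rw [← dvd_neg, h1]
    refine Dvd.dvd.mul_right (pow_dvd_pow_of_dvd ⟨-1, by ring⟩ n) _
  have hX1 : IsCoprime (X : F[X]) ((X - 1) ^ n) :=
    IsCoprime.pow_right ⟨1, -1, by ring⟩
  have hX2 : IsCoprime ((X + 1) ^ n : F[X]) (X * (X - 1) ^ n) := by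
    refine IsCoprime.mul_right (IsCoprime.pow_left ⟨1, -1, by ring⟩) hcop.pow
  obtain ⟨R, hR⟩ := hX2.mul_dvd hdvd (hX1.mul_dvd h0 hm)
  have hmon : ((X + 1) ^ n * (X * (X - 1) ^ n) : F[X]).Monic := by
    have h1 : (X + 1 : F[X]).Monic := by simpa using monic_X_add_C (1 : F)
    have h3 : (X - 1 : F[X]).Monic := by simpa using monic_X_sub_C (1 : F)
    exact (h1.pow n).mul (monic_X.mul (h3.pow n))
  have hnd : ((X + 1) ^ n * (X * (X - 1) ^ n) : F[X]).natDegree = 2 * n + 1 := by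
    have h1 : (X + 1 : F[X]).Monic := by simpa using monic_X_add_C (1 : F)
    have h3 : (X - 1 : F[X]).Monic := by simpa using monic_X_sub_C (1 : F)
    rw [(h1.pow n).natDegree_mul (monic_X.mul (h3.pow n)), monic_X.natDegree_mul (h3.pow n),
      h1.natDegree_pow, h3.natDegree_pow, natDegree_X,
      show (X + 1 : F[X]).natDegree = 1 by simpa using natDegree_X_add_C (1 : F),
      show (X - 1 : F[X]).natDegree = 1 by simpa using natDegree_X_sub_C (1 : F)]
    ring
  rcases eq_or_ne R 0 with rfl | hR0
  · exact ⟨0, by simpa using hR⟩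
  · rw [hR, hmon.natDegree_mul' hR0, hnd] at hdeg
    refine ⟨R.coeff 0, ?_⟩
    rw [hR, mul_comm]
    congr 1
    exact eq_C_of_natDegree_eq_zero (by omega)

/-- The coefficient equals `-(-2) ^ (n - r) * (n + 1 + r) / (n + 1) * (n + 1).choose r`, with an
integer exponent `n - r`, and all these factors are nonzero. -/
theorem coeff_X_sub_one_mul_X_sub_two_pow_ne_zero {n r : ℕ} (hr : r ≤ n + 1)
    (hF : (((2 * n + 2)! : ℕ) : F) ≠ 0) :
    ((X - 1) * (X + C (-2)) ^ n : F[X]).coeff r ≠ 0 := by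
  have h2 : (2 : F) ≠ 0 := by
    exact_mod_cast natCast_ne_zero_of_le_of_factorial (a := 2) (by simp) (by omega) hF
  rw [sub_mul, one_mul, coeff_sub]
  rcases r with _ | s
  · rw [coeff_X_add_C_pow]
    simp [h2]
  · rw [coeff_X_mul, coeff_X_add_C_pow, coeff_X_add_C_pow]
    rcases Nat.lt_or_ge s n with hs | hs
    · obtain ⟨t, rfl⟩ := Nat.exists_eq_add_of_lt hs
      have e1 : s + t + 1 - s = t + 1 := by omega
      have e2 : s + t + 1 - (s + 1) = t := by omega
      rw [e1, e2]
      set n := s + t + 1 with hn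
      have key : ((n + 1 : ℕ) : F) * (2 * (n.choose s : F) + (n.choose (s + 1) : F)) =
          ((n + s + 2 : ℕ) : F) * (((n + 1).choose (s + 1) : ℕ) : F) := by
        have h1 := Nat.add_one_mul_choose_eq n s
        have h3 := Nat.choose_succ_succ n s
        simp only [Nat.succ_eq_add_one] at h1 h3
        have : (n + 1) * (2 * n.choose s + n.choose (s + 1)) =
            (n + s + 2) * (n + 1).choose (s + 1) := by
          calc _ = (n + 1) * n.choose s + (n + 1) * (n.choose s + n.choose (s + 1)) := by ring
            _ = _ := by rw [h1, ← h3]; ring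
        have := congrArg (Nat.cast (R := F)) this
        push_cast at this ⊢
        exact this
      have hne : (2 * (n.choose s : F) + (n.choose (s + 1) : F)) ≠ 0 := by
        refine right_ne_zero_of_mul (a := ((n + 1 : ℕ) : F)) ?_
        rw [key]
        exact mul_ne_zero (natCast_ne_zero_of_le_of_factorial (by omega) (by omega) hF)
          (natCast_choose_ne_zero_of_factorial hr
            (natCast_factorial_ne_zero_of_le (by omega) hF))
      have : (-2 : F) ^ (t + 1) * (n.choose s : F) - (-2) ^ t * (n.choose (s + 1) : F) =
          -(-2) ^ t * (2 * (n.choose s : F) + (n.choose (s + 1) : F)) := by ring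
      rw [this]
      exact mul_ne_zero (neg_ne_zero.2 (pow_ne_zero _ (neg_ne_zero.2 h2))) hne
    · obtain rfl : s = n := by omega
      simp

/-- The determinant is a nonzero multiple of the binomial determinant `det ((k i).choose (2 * j))`,
where `k` enumerates `{n, …, 2 * n + 1} \ {n + r}`. A linear relation `c` between its rows makes
the even coefficients of `∑ i, c i * (1 + X) ^ k i` vanish, so this odd polynomial is a
multiple of `X * (X - 1) ^ n * (X + 1) ^ n`. After the substitution `X ↦ X - 1`, the
coefficient of `X ^ (n + r)` shows that the multiple is zero. -/
theorem det_inv_factorial_ne_zero {n : ℕ} (r : Fin (n + 2))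
    (hF : (((2 * n + 2)! : ℕ) : F) ≠ 0) :
    (Matrix.of fun i j : Fin (n + 1) =>
      if 2 * (j : ℕ) ≤ n + (r.succAbove i : ℕ) then
        (((n + (r.succAbove i : ℕ) - 2 * (j : ℕ))! : ℕ) : F)⁻¹ else 0).det ≠ 0 := by
  have h2 : (2 : F) ≠ 0 := by
    exact_mod_cast natCast_ne_zero_of_le_of_factorial (a := 2) (by simp) (by omega) hF
  have hfac : ∀ a ≤ 2 * n + 2, ((a ! : ℕ) : F) ≠ 0 := fun a ha =>
    natCast_factorial_ne_zero_of_le ha hF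
  intro hdet
  obtain ⟨v, hv0, hv⟩ := Matrix.exists_vecMul_eq_zero_iff.2 hdet
  apply hv0
  set k : Fin (n + 1) → ℕ := fun i => n + (r.succAbove i : ℕ) with hk
  have hkle : ∀ i, k i ≤ 2 * n + 1 := fun i => by have := (r.succAbove i).2; simp only [hk]; omega
  -- Row `i` of the matrix is `((k i)!)⁻¹` times a row of binomial coefficients, up to the column
  -- factors `(2 * j)!`.
  set c : Fin (n + 1) → F := fun i => v i * (((k i)! : ℕ) : F)⁻¹ with hc
  set L : F[X] := ∑ i, C (c i) * X ^ (r.succAbove i : ℕ) with hL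
  have hLtay : taylor 1 (X ^ n * L) = ∑ i, C (c i) * (X + 1) ^ k i := by
    rw [hL, Finset.mul_sum, map_sum]
    refine Finset.sum_congr rfl fun i _ => ?_
    rw [show (X ^ n * (C (c i) * X ^ (r.succAbove i : ℕ)) : F[X]) = C (c i) * X ^ k i by
      simp only [hk, pow_add]; ring]
    simp [taylor_mul, taylor_pow]
  have hcoeff : ∀ m, (taylor 1 (X ^ n * L)).coeff m = ∑ i, c i * ((k i).choose m : F) := by
    intro m
    rw [hLtay, finsetSum_coeff]
    refine Finset.sum_congr rfl fun i _ => ?_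
    rw [coeff_C_mul, coeff_X_add_one_pow]
  have hdeg : (taylor 1 (X ^ n * L)).natDegree ≤ 2 * n + 1 := by
    rw [natDegree_le_iff_coeff_eq_zero]
    intro m hm
    rw [hcoeff]
    refine Finset.sum_eq_zero fun i _ => ?_
    rw [Nat.choose_eq_zero_of_lt (by have := hkle i; omega)]
    simp
  have hodd : ∀ j, (taylor 1 (X ^ n * L)).coeff (2 * j) = 0 := by
    intro j
    rcases Nat.lt_or_ge j (n + 1) with hj | hj
    · have hvj := congrFun hv ⟨j, hj⟩
      simp only [Matrix.vecMul, dotProduct, Matrix.of_apply, Pi.zero_apply] at hvj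
      have hterm : ∀ i, c i * ((k i).choose (2 * j) : F) = (((2 * j)! : ℕ) : F)⁻¹ *
          (v i * if 2 * j ≤ k i then (((k i - 2 * j)! : ℕ) : F)⁻¹ else 0) := by
        intro i
        split_ifs with h
        · have e := congrArg (Nat.cast (R := F)) (Nat.choose_mul_factorial_mul_factorial h)
          push_cast at e
          have h3 := hfac (k i) (by have := hkle i; omega)
          have h4 := hfac (2 * j) (by omega)
          have h5 := hfac (k i - 2 * j) (by have := hkle i; omega)
          simp only [hc]
          field_simp
          rw [← e]
          ring
        · simp [Nat.choose_eq_zero_of_lt (not_le.1 h)]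
      rw [hcoeff, Finset.sum_congr rfl fun i _ => hterm i, ← Finset.mul_sum]
      exact mul_eq_zero_of_right _ hvj
    · exact coeff_eq_zero_of_natDegree_lt (by omega)
  obtain ⟨γ, hγ⟩ := eq_C_mul_of_odd_of_dvd h2 hdeg hodd
    (by rw [taylor_mul, taylor_pow, taylor_X, C_1]; exact dvd_mul_right _ _)
  have hLt : taylor 1 L = C γ * (X * (X - 1) ^ n) := by
    rw [taylor_mul, taylor_pow, taylor_X, C_1] at hγ
    have hne : ((X + 1) ^ n : F[X]) ≠ 0 := pow_ne_zero _ (by simpa using X_add_C_ne_zero (1 : F))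
    apply mul_left_cancel₀ hne
    rw [hγ]; ring
  have hLeq : L = C γ * ((X - 1) * (X + C (-2)) ^ n) := by
    apply taylor_injective (1 : F)
    rw [hLt]
    simp only [taylor_mul, taylor_pow, map_sub, map_add, taylor_X, taylor_C, taylor_one, C_1]
    rw [show (X + 1 + C (-2) : F[X]) = X - 1 by
      rw [C_neg, show (C 2 : F[X]) = 2 from rfl]; ring]
    ring
  have hLcoeff : ∀ m, L.coeff m = ∑ i, if m = (r.succAbove i : ℕ) then c i else 0 := by
    intro m
    simp [hL, coeff_X_pow]
  have hγ0 : γ = 0 := by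
    -- The exponent `r` does not occur in `L`.
    have h1 := hLcoeff r
    rw [Finset.sum_eq_zero fun i _ => if_neg fun h => Fin.succAbove_ne r i (Fin.ext h.symm),
      hLeq, coeff_C_mul] at h1
    exact (mul_eq_zero.1 h1).resolve_right
      (coeff_X_sub_one_mul_X_sub_two_pow_ne_zero (by have := r.2; omega) hF)
  funext i
  have h1 := hLcoeff (r.succAbove i)
  rw [hLeq, hγ0, C_0, zero_mul, coeff_zero, Finset.sum_eq_single i
    (fun b _ hb => if_neg fun h => hb
      (Fin.succAbove_right_injective (p := r) (Fin.ext h.symm))) (by simp), if_pos rfl] at h1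
  exact (mul_eq_zero.1 h1.symm).resolve_right (inv_ne_zero (hfac _ (by have := hkle i; omega)))

end OddPolynomials

/-! ### Coefficients and the Combinatorial Nullstellensatz -/

section Coefficients

open MvPolynomial
open scoped Nat

variable {F ι : Type*} [Field F] [Fintype ι]

/-- In top degree the translations by the elements of `T` are invisible. -/
theorem coeff_mul_prod_sum_X_sub_C {N : ℕ} {V : MvPolynomial ι F} (hV : V.IsHomogeneous N)
    (T : Finset F) {k : ι →₀ ℕ} (hk : k.degree = N + T.card) :
    coeff k (V * ∏ b ∈ T, (∑ i, X i - C b)) = coeff k (V * (∑ i, X i) ^ T.card) := by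
  classical
  have hs : (∑ i : ι, X i : MvPolynomial ι F).IsHomogeneous 1 :=
    IsHomogeneous.sum _ _ _ fun i _ => isHomogeneous_X F i
  have hsub : ∀ b : F, (∑ i : ι, X i - C b : MvPolynomial ι F).totalDegree ≤ 1 := fun b =>
    (totalDegree_sub_C_le _ _).trans hs.totalDegree_le
  induction T using Finset.induction_on generalizing N V with
  | empty => simp
  | insert b T hb ih =>
    rw [Finset.card_insert_of_notMem hb] at hk ⊢
    rw [Finset.prod_insert hb, show V * ((∑ i, X i - C b) * ∏ b ∈ T, (∑ i, X i - C b)) =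
      V * ∑ i, X i * ∏ b ∈ T, (∑ i, X i - C b) - C b * (V * ∏ b ∈ T, (∑ i, X i - C b)) by
        rw [← Finset.sum_mul]; ring]
    rw [coeff_sub, coeff_C_mul, ← Finset.sum_mul, ← mul_assoc, ih (hV.mul hs) (by omega),
      pow_succ', mul_assoc]
    have hlow : coeff k (V * ∏ b ∈ T, (∑ i, X i - C b)) = 0 := by
      refine coeff_eq_zero_of_totalDegree_lt ?_
      have h1 : (∏ b ∈ T, (∑ i : ι, X i - C b : MvPolynomial ι F)).totalDegree ≤ T.card := by
        refine (totalDegree_finsetProd _ _).trans ?_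
        simpa using Finset.sum_le_card_nsmul T _ 1 fun b _ => hsub b
      have h2 := totalDegree_mul V (∏ b ∈ T, (∑ i : ι, X i - C b : MvPolynomial ι F))
      have h3 := hV.totalDegree_le
      have h4 : ∑ i ∈ k.support, k i = k.degree := rfl
      omega
    rw [hlow, mul_zero, sub_zero]

theorem coeff_prod_X_pow_mul_sum_X_pow {m : ℕ} (hm : ((m ! : ℕ) : F) ≠ 0) (e : ι → ℕ)
    {k : ι →₀ ℕ} (hk : ∑ i, k i = ∑ i, e i + m) :
    coeff k ((∏ i, X i ^ e i) * (∑ i, X i) ^ m) =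
      ((m ! : ℕ) : F) * ∏ i, if e i ≤ k i then (((k i - e i)! : ℕ) : F)⁻¹ else 0 := by
  classical
  set e' : ι →₀ ℕ := Finsupp.equivFunOnFinite.symm e with he'
  have hmon : (∏ i, X i ^ e i : MvPolynomial ι F) = monomial e' 1 := by
    rw [monomial_eq, C_1, one_mul, Finsupp.prod_fintype _ _ (by simp)]
    rfl
  rw [hmon, coeff_monomial_mul', one_mul]
  by_cases hle : e' ≤ k
  · have hle' : ∀ i, e i ≤ k i := hle
    have hsum : ∑ i, (k i - e i) = m := by
      have := Finset.sum_tsub_distrib Finset.univ (f := k) (g := e) fun i _ => hle' i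
      omega
    rw [if_pos hle, coeff_sum_X_pow_of_fintype, if_pos]
    · rw [Finset.prod_congr rfl fun i _ => if_pos (hle' i), Finset.prod_inv_distrib]
      have hspec := Nat.multinomial_spec Finset.univ (fun i => k i - e i)
      rw [hsum] at hspec
      have hmul : (k - e').multinomial = Nat.multinomial Finset.univ (fun i => k i - e i) := by
        rw [Finsupp.multinomial_eq_of_support_subset (Finset.subset_univ _)]
        rfl
      rw [hmul]
      have h := congrArg (Nat.cast (R := F)) hspec
      rw [Nat.cast_mul, Nat.cast_prod] at h
      have hne : ∏ i, (((k i - e i)! : ℕ) : F) ≠ 0 := by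
        rw [← h] at hm
        exact left_ne_zero_of_mul hm
      rw [← h]
      field_simp
    · rw [Finsupp.sum_fintype _ _ (by simp)]
      exact hsum
  · rw [if_neg hle]
    obtain ⟨i, hi⟩ : ∃ i, ¬ e i ≤ k i := by
      by_contra! h
      exact hle h
    rw [Finset.prod_eq_zero (Finset.mem_univ i) (if_neg hi), mul_zero]

/-- The expansion of a determinant turns the coefficient of a Vandermonde determinant in the squares
of the variables times a power of their sum into the determinant of inverse factorials. -/
theorem coeff_det_vandermonde_sq_mul_sum_X_pow {d m : ℕ} (hm : ((m ! : ℕ) : F) ≠ 0)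
    {k : Fin d →₀ ℕ} (hk : ∑ i, k i = d * (d - 1) + m) :
    coeff k ((Matrix.vandermonde fun i : Fin d => (X i ^ 2 : MvPolynomial (Fin d) F)).det *
        (∑ i, X i) ^ m) =
      ((m ! : ℕ) : F) * (Matrix.of fun i j : Fin d =>
        if 2 * (j : ℕ) ≤ k i then (((k i - 2 * (j : ℕ))! : ℕ) : F)⁻¹ else 0).det := by
  rw [Matrix.det_apply', Matrix.det_apply', Finset.sum_mul, coeff_sum, Finset.mul_sum]
  refine Finset.sum_congr rfl fun σ _ => ?_
  have hprod : (∏ i, Matrix.vandermonde (fun i : Fin d => (X i ^ 2 : MvPolynomial (Fin d) F))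
      (σ i) i) = ∏ i, X i ^ (2 * (σ.symm i : ℕ)) := by
    rw [← Equiv.prod_comp σ fun i => (X i ^ (2 * (σ.symm i : ℕ)) : MvPolynomial (Fin d) F)]
    simp [Matrix.vandermonde_apply, pow_mul]
  have hsum : ∑ i, 2 * (σ.symm i : ℕ) = d * (d - 1) := by
    rw [Equiv.sum_comp σ.symm fun i : Fin d => 2 * (i : ℕ), Fin.sum_univ_eq_sum_range (2 * ·),
      ← Finset.mul_sum, mul_comm, Finset.sum_range_id_mul_two]
  rw [hprod, show ((Equiv.Perm.sign σ : ℤ) : MvPolynomial (Fin d) F) =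
    C (((Equiv.Perm.sign σ : ℤ) : F)) by simp, mul_assoc, coeff_C_mul,
    coeff_prod_X_pow_mul_sum_X_pow hm _ (by rw [hsum, hk]), mul_left_comm]
  congr 2
  rw [← Equiv.prod_comp σ]
  simp

theorem isHomogeneous_det_vandermonde_sq (d : ℕ) :
    (Matrix.vandermonde fun i : Fin d => (X i ^ 2 : MvPolynomial (Fin d) F)).det.IsHomogeneous
      (d * (d - 1)) := by
  rw [Matrix.det_apply']
  refine IsHomogeneous.sum _ _ _ fun σ _ => ?_
  have h1 : (∏ i, Matrix.vandermonde (fun i : Fin d => (X i ^ 2 : MvPolynomial (Fin d) F))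
      (σ i) i).IsHomogeneous (∑ i : Fin d, 2 * (i : ℕ)) := by
    refine IsHomogeneous.prod _ _ _ fun i _ => ?_
    rw [Matrix.vandermonde_apply, ← pow_mul]
    exact isHomogeneous_X_pow _ _
  rw [Fin.sum_univ_eq_sum_range (2 * ·), ← Finset.mul_sum, mul_comm,
    Finset.sum_range_id_mul_two] at h1
  rw [show ((Equiv.Perm.sign σ : ℤ) : MvPolynomial (Fin d) F) =
    C (((Equiv.Perm.sign σ : ℤ) : F)) by simp]
  simpa using (isHomogeneous_C (Fin d) ((Equiv.Perm.sign σ : ℤ) : F)).mul h1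

/-- A lower bound for the number of sums `∑ i, x i` with `x i ∈ S i` and distinct squares
`x i ^ 2`. -/
theorem lt_card_of_sum_mem_of_injective_sq {n : ℕ} (r : Fin (n + 2))
    (hF : (((2 * n + 2)! : ℕ) : F) ≠ 0) {m : ℕ} (hmr : m + r = (n + 1) * (n + 2) / 2)
    (hm : ((m ! : ℕ) : F) ≠ 0) (S : Fin (n + 1) → Finset F)
    (hS : ∀ i, n + (r.succAbove i : ℕ) < (S i).card) (T : Finset F)
    (hT : ∀ x : Fin (n + 1) → F, (∀ i, x i ∈ S i) → Function.Injective (fun i => x i ^ 2) →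
      ∑ i, x i ∈ T) :
    m < T.card := by
  by_contra! hle
  set k : Fin (n + 1) →₀ ℕ :=
    Finsupp.equivFunOnFinite.symm fun i => n + (r.succAbove i : ℕ) with hkdef
  have hksum : ∑ i, k i = (n + 1) * (n + 1 - 1) + m := by
    have h1 := Fin.sum_univ_succAbove (fun j : Fin (n + 2) => (j : ℕ)) r
    rw [Fin.sum_univ_eq_sum_range (fun j => j), Finset.sum_range_id, Nat.add_sub_cancel,
      mul_comm] at h1
    change (n + 1) * (n + 2) / 2 = _ at h1
    have h2 : ∑ i, k i = (n + 1) * n + ∑ i, (r.succAbove i : ℕ) := by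
      simp [hkdef, Finset.sum_add_distrib]
    rw [Nat.add_sub_cancel]
    omega
  have hkdeg : k.degree = (n + 1) * (n + 1 - 1) + m := by
    rw [← hksum, Finsupp.degree_eq_sum]
  have hs : (∑ i : Fin (n + 1), X i : MvPolynomial (Fin (n + 1)) F).IsHomogeneous 1 :=
    IsHomogeneous.sum _ _ _ fun i _ => isHomogeneous_X F i
  set D : MvPolynomial (Fin (n + 1)) F :=
    (Matrix.vandermonde fun i : Fin (n + 1) => (X i ^ 2 : MvPolynomial (Fin (n + 1)) F)).det
    with hD
  -- The extra power of the sum brings the number of linear factors to exactly `m`.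
  set V : MvPolynomial (Fin (n + 1)) F := D * (∑ i, X i) ^ (m - T.card) with hVdef
  have hV : V.IsHomogeneous ((n + 1) * (n + 1 - 1) + (m - T.card)) := by
    simpa using (isHomogeneous_det_vandermonde_sq (F := F) (n + 1)).mul (hs.pow (m - T.card))
  set f : MvPolynomial (Fin (n + 1)) F := V * ∏ b ∈ T, (∑ i, X i - C b) with hf
  have hcoeff : coeff k f ≠ 0 := by
    rw [hf, coeff_mul_prod_sum_X_sub_C hV T (by omega), hVdef, mul_assoc, ← pow_add,
      Nat.sub_add_cancel hle, hD, coeff_det_vandermonde_sq_mul_sum_X_pow hm hksum]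
    exact mul_ne_zero hm (det_inv_factorial_ne_zero r hF)
  have hdeg : f.totalDegree = k.degree := by
    refine le_antisymm ?_ (le_totalDegree (mem_support_iff.2 hcoeff))
    have h1 : (∏ b ∈ T, (∑ i : Fin (n + 1), X i - C b : MvPolynomial (Fin (n + 1)) F)).totalDegree
        ≤ T.card := by
      refine (totalDegree_finsetProd _ _).trans ?_
      simpa using Finset.sum_le_card_nsmul T _ 1 fun b _ =>
        (totalDegree_sub_C_le (∑ i : Fin (n + 1), X i : MvPolynomial (Fin (n + 1)) F) b).trans
          hs.totalDegree_le
    have h2 := totalDegree_mul V (∏ b ∈ T, (∑ i : Fin (n + 1), X i - C b))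
    rw [← hf] at h2
    have h3 := hV.totalDegree_le
    omega
  obtain ⟨x, hxS, hx⟩ := combinatorial_nullstellensatz_exists_eval_nonzero f k hcoeff hdeg S hS
  rw [hf, hVdef, map_mul, map_mul] at hx
  have hinj : Function.Injective fun i => x i ^ 2 := by
    rw [← Matrix.det_vandermonde_ne_zero_iff]
    have h1 := left_ne_zero_of_mul (left_ne_zero_of_mul hx)
    rw [hD, Matrix.det_vandermonde] at h1
    rw [Matrix.det_vandermonde]
    simpa using h1
  refine right_ne_zero_of_mul hx ?_
  rw [map_prod]
  exact Finset.prod_eq_zero (hT x hxS hinj) (by simp)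

end Coefficients

/-! ### Subset sums -/

section SubsetSums

open Finset
open scoped Nat

/-- Elements of `A ∪ -A` with distinct squares are, up to order and signs, the elements of `A`;
the set `I` consists of those that occur with the sign `+`. -/
theorem exists_subset_sum_eq_two_mul_sub {R ι : Type*} [CommRing R] [DecidableEq R] [Fintype ι]
    {A : Finset R} (hcard : A.card = Fintype.card ι) {x : ι → R} (hx : ∀ i, x i ∈ A ∪ -A)
    (hinj : Function.Injective fun i => x i ^ 2) :
    ∃ I ⊆ A, (∀ i, x i ∈ A → x i ∈ I) ∧ ∑ i, x i = 2 * ∑ a ∈ I, a - ∑ a ∈ A, a := by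
  classical
  set e : ι → R := fun i => if x i ∈ A then x i else -x i with he
  have heA : ∀ i, e i ∈ A := by
    intro i
    simp only [he]
    split_ifs with h
    · exact h
    · simpa [h] using hx i
  have hesq : ∀ i, e i ^ 2 = x i ^ 2 := by
    intro i
    simp only [he]
    split_ifs <;> ring
  have heinj : Function.Injective e := fun i j hij => hinj (by
    change x i ^ 2 = x j ^ 2
    rw [← hesq, ← hesq, hij])
  have himage : univ.image e = A := by
    refine eq_of_subset_of_card_le (image_subset_iff.2 fun i _ => heA i) ?_
    rw [card_image_of_injective _ heinj, hcard, card_univ]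
  refine ⟨(univ.filter fun i => x i ∈ A).image e, image_subset_iff.2 fun i _ => heA i,
    fun i hi => mem_image.2 ⟨i, by simpa using hi, if_pos hi⟩, ?_⟩
  rw [sum_image heinj.injOn, ← himage, sum_image heinj.injOn, himage, sum_filter, mul_sum,
    ← sum_sub_distrib]
  refine sum_congr rfl fun i _ => ?_
  simp only [he]
  split_ifs <;> ring

variable {p : ℕ}

theorem natCast_factorial_ne_zero_of_lt (hp : p.Prime) {m : ℕ} (hm : m < p) :
    ((m ! : ℕ) : ZMod p) ≠ 0 := by
  rw [Ne, ZMod.natCast_eq_zero_iff, hp.dvd_factorial]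
  omega

theorem card_union_neg {A : Finset (ZMod p)} (hA : A ∩ (-A) = ∅) :
    (A ∪ -A).card = 2 * A.card := by
  rw [card_union_of_disjoint (disjoint_iff_inter_eq_empty.2 hA), card_neg, two_mul]

theorem two_mul_card_lt (hp : p.Prime) {A : Finset (ZMod p)} (hA : A ∩ (-A) = ∅) :
    2 * A.card < p := by
  have : NeZero p := ⟨hp.ne_zero⟩
  rw [← card_union_neg hA]
  have h0 : (0 : ZMod p) ∉ A ∪ -A := by
    intro h
    have h1 : (0 : ZMod p) ∈ A := by simpa using h
    have h2 : (0 : ZMod p) ∈ A ∩ -A := by simpa using h1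
    simp [hA] at h2
  simpa using card_lt_univ_of_notMem h0

theorem nontrivialSubsums_mono {A B : Finset (ZMod p)} (h : A ⊆ B) :
    nontrivialSubsums A ⊆ nontrivialSubsums B := by
  intro s hs
  obtain ⟨I, ⟨hI, hne⟩, rfl⟩ := mem_nontrivialSubsums.1 hs
  exact mem_nontrivialSubsums.2 ⟨I, ⟨hI.trans h, hne⟩, rfl⟩

theorem nontrivialSubsums_subset_subsetSum (A : Finset (ZMod p)) :
    nontrivialSubsums A ⊆ A.subsetSum := by
  intro s hs
  obtain ⟨I, ⟨hI, -⟩, rfl⟩ := mem_nontrivialSubsums.1 hs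
  exact mem_subsetSum_iff.2 ⟨I, hI, rfl⟩

/-- The bound for signed sums applied to `S i = A ∪ -A`, except that `S i = A` where the exponent is
`n`. This exponent occurs exactly if `r ≠ 0`, and then every sum under consideration has a term from
`A`, so that it comes from a nonempty subset. -/
theorem lt_card_subsetSum_and_lt_card_nontrivialSubsums (hp : p.Prime) {n : ℕ}
    {A : Finset (ZMod p)} (hA : A ∩ (-A) = ∅) (hcard : A.card = n + 1) (r : Fin (n + 2)) {m : ℕ}
    (hmr : m + r = (n + 1) * (n + 2) / 2) (hmp : m < p) :
    m < A.subsetSum.card ∧ (r ≠ 0 → m < (nontrivialSubsums A).card) := by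
  have : Fact p.Prime := ⟨hp⟩
  have hlt := two_mul_card_lt hp hA
  have hF : (((2 * n + 2)! : ℕ) : ZMod p) ≠ 0 := natCast_factorial_ne_zero_of_lt hp (by omega)
  have hm := natCast_factorial_ne_zero_of_lt hp hmp
  have hex : ∀ i : Fin (n + 1), ∃ S ⊆ A ∪ -A, n + (r.succAbove i : ℕ) < S.card ∧
      ((r.succAbove i : ℕ) = 0 → S = A) := by
    intro i
    by_cases h : (r.succAbove i : ℕ) = 0
    · exact ⟨A, subset_union_left, by omega, fun _ => rfl⟩
    · refine ⟨A ∪ -A, Subset.rfl, ?_, fun h' => absurd h' h⟩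
      have := (r.succAbove i).2
      rw [card_union_neg hA]
      omega
  choose S hSsub hScard hSA using hex
  have main : ∀ T : Finset (ZMod p), (∀ x : Fin (n + 1) → ZMod p, (∀ i, x i ∈ S i) →
      ∀ I ⊆ A, (∀ i, x i ∈ A → x i ∈ I) → ∑ a ∈ I, a ∈ T) → m < T.card := by
    intro T hT
    refine (lt_card_of_sum_mem_of_injective_sq r hF hmr hm S hScard
      (T.image fun t => 2 * t - ∑ a ∈ A, a) ?_).trans_le card_image_le
    intro x hxS hinj
    obtain ⟨I, hIA, hI, hsum⟩ := exists_subset_sum_eq_two_mul_sub (by simpa using hcard)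
      (fun i => hSsub i (hxS i)) hinj
    exact mem_image.2 ⟨_, hT x hxS I hIA hI, hsum.symm⟩
  refine ⟨main _ fun x _ I hIA _ => mem_subsetSum_iff.2 ⟨I, hIA, rfl⟩, fun hr => main _ ?_⟩
  intro x hxS I hIA hI
  have h0 : x 0 ∈ A := by
    have h := hxS 0
    rwa [hSA 0 (by rw [Fin.succAbove_ne_zero_zero hr]; rfl)] at h
  exact mem_nontrivialSubsums.2 ⟨I, ⟨hIA, _, hI 0 h0⟩, rfl⟩

theorem exists_add_eq_triangular {m d : ℕ} (h : m < d * (d + 1) / 2) :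
    ∃ n < d, ∃ r ≤ n + 1, r ≠ 0 ∧ m + r = (n + 1) * (n + 2) / 2 := by
  induction d with
  | zero => simp at h
  | succ d ih =>
    by_cases hd : m < d * (d + 1) / 2
    · obtain ⟨n, hn, r, hr⟩ := ih hd
      exact ⟨n, by omega, r, hr⟩
    · have e : (d + 1) * (d + 2) / 2 = d * (d + 1) / 2 + (d + 1) := by
        rw [show (d + 1) * (d + 2) = d * (d + 1) + (d + 1) * 2 by ring,
          Nat.add_mul_div_right _ _ two_pos]
      rw [show d + 1 + 1 = d + 2 from rfl, e] at h
      exact ⟨d, by omega, (d + 1) * (d + 2) / 2 - m, by omega, by omega, by omega⟩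

/-- For every `m` in this range there is a subset of `A` to which
`lt_card_subsetSum_and_lt_card_nontrivialSubsums` applies with some `r ≠ 0`. In particular
`m = p - 1` is allowed when the triangular number of `A.card` is at least `p`. -/
theorem lt_card_nontrivialSubsums (hp : p.Prime) {A : Finset (ZMod p)} (hA : A ∩ (-A) = ∅)
    {m : ℕ} (hm : m < A.card * (A.card + 1) / 2) (hmp : m < p) :
    m < (nontrivialSubsums A).card := by
  obtain ⟨n, hn, r, hr, hr0, hmr⟩ := exists_add_eq_triangular hm
  obtain ⟨B, hBA, hB⟩ := exists_subset_card_eq (show n + 1 ≤ A.card from hn)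
  have hBneg : B ∩ (-B) = ∅ := by
    rw [← subset_empty, ← hA]
    exact inter_subset_inter hBA (neg_subset_neg hBA)
  have h := (lt_card_subsetSum_and_lt_card_nontrivialSubsums hp hBneg hB ⟨r, by omega⟩ hmr hmp).2
    fun h => hr0 (congrArg Fin.val h)
  exact h.trans_le (card_le_card (nontrivialSubsums_mono hBA))

end SubsetSums

theorem mainTheorem1 (p : ℕ) (hp : p.Prime) (hodd : Odd p) (A : Finset (ZMod p))
    (hA : A ∩ (-A) = ∅) :
    min p (1 + A.card * (A.card + 1) / 2) ≤ A.subsetSum.card ∧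
      min p (A.card * (A.card + 1) / 2) ≤ (nontrivialSubsums A).card := by
  have hstar : min p (A.card * (A.card + 1) / 2) ≤ (nontrivialSubsums A).card := by
    by_contra! h
    rw [lt_min_iff] at h
    exact lt_irrefl _ (lt_card_nontrivialSubsums hp hA h.2 h.1)
  refine ⟨?_, hstar⟩
  rcases le_or_gt p (A.card * (A.card + 1) / 2) with hle | hlt
  · have h := Finset.card_le_card (nontrivialSubsums_subset_subsetSum A)
    omega
  · rcases Nat.eq_zero_or_eq_succ_pred A.card with h0 | hcard
    · rw [h0]
      have := Finset.card_pos.2 (Finset.subsetSum_nonempty (A := A))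
      omega
    · have h := (lt_card_subsetSum_and_lt_card_nontrivialSubsums hp hA hcard 0
        (m := A.card * (A.card + 1) / 2) (by rw [hcard]; rfl) hlt).1
      omega
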